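/- All manifolds are smooth ($C^\infty$), real, finite-dimensional, Hausdorff and without boundary; vector bundles are real, smooth and of finite rank. A VB-groupoid $\mathcal V\rightrightarrows E$ over a Lie groupoid $\mathcal G\rightrightarrows M$ (structure maps $s,t,m,i,1$) is a Lie groupoid, with structure maps $\tilde s,\tilde t,\tilde m,\tilde i,\tilde 1$, on the total spaces of vector bundles $\mathcal V\to\mathcal G$ and $E\to M$ such that all its structure maps are vector bundle morphisms over the corresponding structure maps of $\mathcal G\rightrightarrows M$. An LA-groupoid is a VB-groupoid in which $\mathcal V\to\mathcal G$ and $E\to M$ are Lie algebroids and all the structure maps $\tilde s,\tilde t,\tilde m,\tilde i,\tilde 1$ are Lie algebroid morphisms over the corresponding structure maps of $\mathcal G\rightrightarrows M$ (for $\tilde m$, the source is the fibre product Lie algebroid $\mathcal V\times_E\mathcal V\to\mathcal G\times_M\mathcal G$). Let $\mathcal V\rightrightarrows E$ be an LA-groupoid over $\mathcal G\rightrightarrows M$, and let $C=\ker(\tilde s)|_M\to M$ be its core, where $M\subseteq\mathcal G$ via the units. For $c\in\Gamma(C)$ let $c^r,c^l\in\Gamma(\mathcal V)$ be $$c^r(g)=c(t(g))\cdot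 \tilde 0_g,\qquad c^l(g)=-\,\tilde 0_g\cdot\tilde i(c(s(g))).$$ Let $\Gamma_{mult}(\mathcal V)\subseteq\Gamma(\mathcal V)$ be the set of multiplicative sections, i.e. those $V\in\Gamma(\mathcal V)$ for which there is $e\in\Gamma(E)$ such that $V:\mathcal G\to\mathcal V$ is a morphism of Lie groupoids covering $e:M\to E$. **Theorem.** 1. $\Gamma_{mult}(\mathcal V)$ is a Lie subalgebra of $(\Gamma(\mathcal V),[\cdot,\cdot]_{\mathcal V})$. 2. For all $c_1,c_2\in\Gamma(C)$ there is a unique $[c_1,c_2]_C\in\Gamma(C)$ with $[c_1,c_2]_C^{\,r}=[c_1^r,c_2^r]_{\mathcal V}$, and this makes $\Gamma(C)$ a real Lie algebra. 3. The maps $$\Gamma(C)\xrightarrow{\ \delta\ }\Gamma_{mult}(\mathcal V)\xrightarrow{\ D\ }\mathrm{Der}(\Gamma(C)),\qquad \delta(c)=c^r-c^l,\quad D_V(c)=[V,c^r]_{\mathcal V}\circ 1,$$ are well defined and form a crossed module of Lie algebras: $\delta$ and $D$ are morphisms of Lie algebras ($\mathrm{Der}$ denoting Lie algebra derivations), $D_{\delta(c)}(b)=[c,b]_C$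 for all $b,c\in\Gamma(C)$, and $\delta(D_V(c))=[V,\delta(c)]_{\mathcal V}$ for all $V\in\Gamma_{mult}(\mathcal V)$, $c\in\Gamma(C)$. -/

import Mathlib

open Bundle Topology Filter
open scoped Manifold ContDiff

set_option linter.unusedSectionVars false

noncomputable section

/-! ### Lie groupoids -/

/-- A Lie groupoid `G ⇉ M`.  The product `mul g h` is only meaningful on composable pairs,
`src g = tgt h`; its values on other pairs are irrelevant and unconstrained.  Smoothness of the
multiplication is smoothness on the set of composable pairs, an embedded submanifold of `G × G`. -/
structure LieGroupoid {EG HG EM HM : Type*}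
    [NormedAddCommGroup EG] [NormedSpace ℝ EG] [TopologicalSpace HG]
    [NormedAddCommGroup EM] [NormedSpace ℝ EM] [TopologicalSpace HM]
    (I : ModelWithCorners ℝ EG HG) (J : ModelWithCorners ℝ EM HM)
    (G M : Type*) [TopologicalSpace G] [ChartedSpace HG G]
    [TopologicalSpace M] [ChartedSpace HM M] where
  src : G → M
  tgt : G → M
  one : M → G
  inv : G → G
  mul : G → G → G
  src_one : ∀ x, src (one x) = x
  tgt_one : ∀ x, tgt (one x) = x
  src_mul : ∀ g h, src g = tgt h → src (mul g h) = src h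
  tgt_mul : ∀ g h, src g = tgt h → tgt (mul g h) = tgt g
  mul_assoc : ∀ g h k, src g = tgt h → src h = tgt k → mul (mul g h) k = mul g (mul h k)
  one_mul : ∀ g, mul (one (tgt g)) g = g
  mul_one : ∀ g, mul g (one (src g)) = g
  src_inv : ∀ g, src (inv g) = tgt g
  tgt_inv : ∀ g, tgt (inv g) = src g
  inv_mul : ∀ g, mul (inv g) g = one (src g)
  mul_inv : ∀ g, mul g (inv g) = one (tgt g)
  contMDiff_src : ContMDiff I J ∞ src
  contMDiff_tgt : ContMDiff I J ∞ tgt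
  contMDiff_one : ContMDiff J I ∞ one
  contMDiff_inv : ContMDiff I I ∞ inv
  contMDiffOn_mul : ContMDiffOn (I.prod I) I ∞ (fun p : G × G ↦ mul p.1 p.2)
    {p : G × G | src p.1 = tgt p.2}
  /-- The source map is a submersion (hence so is the target map, which is `src ∘ inv`). -/
  submersion_src : ∀ g, Function.Surjective (mfderiv I J src g)

namespace LieGroupoid

variable {EG HG EM HM EG' HG' EM' HM' : Type*}
  [NormedAddCommGroup EG] [NormedSpace ℝ EG] [TopologicalSpace HG]
  [NormedAddCommGroup EM] [NormedSpace ℝ EM] [TopologicalSpace HM]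
  [NormedAddCommGroup EG'] [NormedSpace ℝ EG'] [TopologicalSpace HG']
  [NormedAddCommGroup EM'] [NormedSpace ℝ EM'] [TopologicalSpace HM']
  {I : ModelWithCorners ℝ EG HG} {J : ModelWithCorners ℝ EM HM}
  {I' : ModelWithCorners ℝ EG' HG'} {J' : ModelWithCorners ℝ EM' HM'}
  {G M G' M' : Type*}
  [TopologicalSpace G] [ChartedSpace HG G] [TopologicalSpace M] [ChartedSpace HM M]
  [TopologicalSpace G'] [ChartedSpace HG' G'] [TopologicalSpace M'] [ChartedSpace HM' M']

/-- The set of composable pairs `G⁽²⁾ ⊆ G × G`. -/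
def composable (𝒢 : LieGroupoid I J G M) : Set (G × G) := {p | 𝒢.src p.1 = 𝒢.tgt p.2}

/-- `Φ : G → G'` is a morphism of Lie groupoids covering `φ : M → M'`. -/
structure IsMorphism (𝒢 : LieGroupoid I J G M) (𝒢' : LieGroupoid I' J' G' M')
    (Φ : G → G') (φ : M → M') : Prop where
  contMDiff : ContMDiff I I' ∞ Φ
  contMDiff_base : ContMDiff J J' ∞ φ
  src : ∀ g, 𝒢'.src (Φ g) = φ (𝒢.src g)
  tgt : ∀ g, 𝒢'.tgt (Φ g) = φ (𝒢.tgt g)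
  one : ∀ x, Φ (𝒢.one x) = 𝒢'.one (φ x)
  mul : ∀ g h, 𝒢.src g = 𝒢.tgt h → Φ (𝒢.mul g h) = 𝒢'.mul (Φ g) (Φ h)

end LieGroupoid

/-! ### Vector bundle maps and smooth sections -/

/-- `Φ` maps each fibre `A b` linearly to the fibre `A' (φ b)`. -/
def IsFiberwiseLinear {B B' F F' : Type*} {A : B → Type*} {A' : B' → Type*}
    [∀ b, AddCommGroup (A b)] [∀ b, Module ℝ (A b)]
    [∀ b, AddCommGroup (A' b)] [∀ b, Module ℝ (A' b)]
    (φ : B → B') (Φ : TotalSpace F A → TotalSpace F' A') : Prop :=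
  ∀ b, ∃ L : A b →ₗ[ℝ] A' (φ b), ∀ v : A b, Φ ⟨b, v⟩ = ⟨φ b, L v⟩

section Sections

variable {EB HB : Type*} [NormedAddCommGroup EB] [NormedSpace ℝ EB] [TopologicalSpace HB]
  {I : ModelWithCorners ℝ EB HB}
  {B : Type*} [TopologicalSpace B] [ChartedSpace HB B]
  {F : Type*} [NormedAddCommGroup F] [NormedSpace ℝ F]
  {A : B → Type*} [TopologicalSpace (TotalSpace F A)]
  [∀ b, TopologicalSpace (A b)] [FiberBundle F A]

/-- A smooth map `Φ : B → A` with `Φ b` in the fibre over `b`, seen as a smooth section. -/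
def sectionOfMap (Φ : B → TotalSpace F A) (hΦ : ContMDiff I (I.prod 𝓘(ℝ, F)) ∞ Φ)
    (hp : ∀ b, (Φ b).proj = b) : Cₛ^∞⟮I; F, A⟯ where
  toFun b := (hp b) ▸ (Φ b).2
  contMDiff_toFun := by
    convert hΦ using 1
    funext b
    have : ∀ (z : TotalSpace F A) (c : B) (h : z.proj = c),
        (⟨c, h ▸ z.2⟩ : TotalSpace F A) = z := by
      rintro ⟨b, v⟩ c rfl; rfl
    exact this (Φ b) b (hp b)

theorem sectionOfMap_spec (Φ : B → TotalSpace F A) (hΦ : ContMDiff I (I.prod 𝓘(ℝ, F)) ∞ Φ)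
    (hp : ∀ b, (Φ b).proj = b) (b : B) :
    (⟨b, sectionOfMap Φ hΦ hp b⟩ : TotalSpace F A) = Φ b := by
  have : ∀ (z : TotalSpace F A) (c : B) (h : z.proj = c),
      (⟨c, h ▸ z.2⟩ : TotalSpace F A) = z := by
    rintro ⟨b, v⟩ c rfl; rfl
  exact this (Φ b) b (hp b)

end Sections

/-! ### Lie algebroids -/

/-- A Lie algebroid structure on the smooth vector bundle `A → B`: an anchor `A → TB` (a smooth
bundle map over the identity) and a Lie bracket on the smooth sections satisfying the Leibniz rule
`[X, f Y] = f [X, Y] + (ρ(X) f) Y`.  (That the anchor preserves brackets follows.) -/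
class LieAlgebroid {EB HB : Type*} [NormedAddCommGroup EB] [NormedSpace ℝ EB]
    [TopologicalSpace HB] (I : ModelWithCorners ℝ EB HB)
    {B : Type*} [TopologicalSpace B] [ChartedSpace HB B] [IsManifold I ∞ B]
    (F : Type*) [NormedAddCommGroup F] [NormedSpace ℝ F]
    (A : B → Type*) [TopologicalSpace (TotalSpace F A)]
    [∀ b, AddCommGroup (A b)] [∀ b, Module ℝ (A b)] [∀ b, TopologicalSpace (A b)]
    [FiberBundle F A] [VectorBundle ℝ F A] [ContMDiffVectorBundle ∞ F A I] where
  anchor : ∀ b : B, A b →ₗ[ℝ] TangentSpace I b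
  contMDiff_anchor : ContMDiff (I.prod 𝓘(ℝ, F)) I.tangent ∞
    (fun v : TotalSpace F A ↦ (⟨v.proj, anchor v.proj v.2⟩ : TangentBundle I B))
  bracket : Cₛ^∞⟮I; F, A⟯ → Cₛ^∞⟮I; F, A⟯ → Cₛ^∞⟮I; F, A⟯
  add_bracket : ∀ X Y Z, bracket (X + Y) Z = bracket X Z + bracket Y Z
  bracket_add : ∀ X Y Z, bracket X (Y + Z) = bracket X Y + bracket X Z
  bracket_smul : ∀ (a : ℝ) X Y, bracket X (a • Y) = a • bracket X Y
  bracket_self : ∀ X, bracket X X = 0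
  jacobi : ∀ X Y Z, bracket X (bracket Y Z) = bracket (bracket X Y) Z + bracket Y (bracket X Z)
  leibniz : ∀ (X Y Z : Cₛ^∞⟮I; F, A⟯) (f : C^∞⟮I, B; 𝓘(ℝ, ℝ), ℝ⟯), (∀ b, Z b = f b • Y b) →
    ∀ b, bracket X Z b = f b • bracket X Y b + (mvfderiv I f b (anchor b (X b))) • Y b

section LieAlgebroid

variable {EN HN : Type*} [NormedAddCommGroup EN] [NormedSpace ℝ EN] [TopologicalSpace HN]
  {K : ModelWithCorners ℝ EN HN}
  {N : Type*} [TopologicalSpace N] [ChartedSpace HN N]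
  {EB HB : Type*} [NormedAddCommGroup EB] [NormedSpace ℝ EB] [TopologicalSpace HB]
  {I : ModelWithCorners ℝ EB HB}
  {B : Type*} [TopologicalSpace B] [ChartedSpace HB B] [IsManifold I ∞ B]
  {F : Type*} [NormedAddCommGroup F] [NormedSpace ℝ F]
  {A : B → Type*} [TopologicalSpace (TotalSpace F A)]
  [∀ b, AddCommGroup (A b)] [∀ b, Module ℝ (A b)] [∀ b, TopologicalSpace (A b)]
  [FiberBundle F A] [VectorBundle ℝ F A] [ContMDiffVectorBundle ∞ F A I]
  {EB' HB' : Type*} [NormedAddCommGroup EB'] [NormedSpace ℝ EB'] [TopologicalSpace HB']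
  {I' : ModelWithCorners ℝ EB' HB'}
  {B' : Type*} [TopologicalSpace B'] [ChartedSpace HB' B'] [IsManifold I' ∞ B']
  {F' : Type*} [NormedAddCommGroup F'] [NormedSpace ℝ F']
  {A' : B' → Type*} [TopologicalSpace (TotalSpace F' A')]
  [∀ b, AddCommGroup (A' b)] [∀ b, Module ℝ (A' b)] [∀ b, TopologicalSpace (A' b)]
  [FiberBundle F' A'] [VectorBundle ℝ F' A'] [ContMDiffVectorBundle ∞ F' A' I']

/-- The Lie ring of smooth sections of a Lie algebroid. -/
instance LieAlgebroid.instLieRing [LieAlgebroid I F A] : LieRing Cₛ^∞⟮I; F, A⟯ where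
  bracket := LieAlgebroid.bracket
  add_lie := LieAlgebroid.add_bracket
  lie_add := LieAlgebroid.bracket_add
  lie_self := LieAlgebroid.bracket_self
  leibniz_lie := LieAlgebroid.jacobi

/-- The real Lie algebra of smooth sections of a Lie algebroid. -/
instance LieAlgebroid.instLieAlgebra [LieAlgebroid I F A] : LieAlgebra ℝ Cₛ^∞⟮I; F, A⟯ where
  lie_smul := LieAlgebroid.bracket_smul

/-- The anchor `A → TB` on total spaces. -/
def anchorMap [LieAlgebroid I F A] (v : TotalSpace F A) : TangentBundle I B :=
  ⟨v.proj, LieAlgebroid.anchor F v.proj v.2⟩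

variable (K I F A) in
/-- A finite expression `∑ᵢ fᵢ · (Xᵢ ∘ ψ)`, with `fᵢ` smooth functions on `N` and `Xᵢ` smooth
sections of `A → B`.  It represents a section of the pullback bundle `ψ^* A` over `N`. -/
structure Expansion (ψ : N → B) where
  size : ℕ
  coeff : Fin size → C^∞⟮K, N; 𝓘(ℝ, ℝ), ℝ⟯
  sec : Fin size → Cₛ^∞⟮I; F, A⟯

/-- The value of the expression at a point. -/
def Expansion.eval {ψ : N → B} (P : Expansion K I F A ψ) (y : N) : A (ψ y) :=
  ∑ i, P.coeff i y • P.sec i (ψ y)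

/-- For `P = ∑ᵢ fᵢ · (Xᵢ ∘ ψ)`, `Q = ∑ⱼ gⱼ · (Yⱼ ∘ ψ)` and tangent vectors `a`, `b` at `y`:
`∑ᵢⱼ fᵢ gⱼ [Xᵢ, Yⱼ] ∘ ψ + ∑ⱼ a(gⱼ) (Yⱼ ∘ ψ) - ∑ᵢ b(fᵢ) (Xᵢ ∘ ψ)`, evaluated at `y`. -/
def Expansion.bracketAt [LieAlgebroid I F A] {ψ : N → B} (P Q : Expansion K I F A ψ) (y : N)
    (a b : TangentSpace K y) : A (ψ y) :=
  ∑ i, ∑ j, (P.coeff i y * Q.coeff j y) • (⁅P.sec i, Q.sec j⁆ : Cₛ^∞⟮I; F, A⟯) (ψ y)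
    + ∑ j, (mvfderiv K (Q.coeff j) y a) • Q.sec j (ψ y)
    - ∑ i, (mvfderiv K (P.coeff i) y b) • P.sec i (ψ y)

variable (I I') in
/-- A morphism of Lie algebroids `Φ : A → A'` covering a smooth map `φ : B → B'`
(Higgins–Mackenzie): a smooth vector bundle map, compatible with the anchors, such that whenever
`Φ ∘ X = ∑ᵢ fᵢ (Xᵢ ∘ φ)` and `Φ ∘ Y = ∑ⱼ gⱼ (Yⱼ ∘ φ)` near a point, then at that point
`Φ ∘ [X, Y] = ∑ᵢⱼ fᵢ gⱼ [Xᵢ, Yⱼ] ∘ φ + ∑ⱼ (ρ(X) gⱼ) (Yⱼ ∘ φ) - ∑ᵢ (ρ(Y) fᵢ) (Xᵢ ∘ φ)`. -/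
structure IsLieAlgebroidMorphism [LieAlgebroid I F A] [LieAlgebroid I' F' A']
    (φ : B → B') (Φ : TotalSpace F A → TotalSpace F' A') : Prop where
  contMDiff_base : ContMDiff I I' ∞ φ
  contMDiff : ContMDiff (I.prod 𝓘(ℝ, F)) (I'.prod 𝓘(ℝ, F')) ∞ Φ
  linear : IsFiberwiseLinear φ Φ
  anchor : ∀ v : TotalSpace F A,
    anchorMap (I := I') (Φ v) = tangentMap I I' φ (anchorMap (I := I) v)
  bracket : ∀ (X Y : Cₛ^∞⟮I; F, A⟯) (b : B) (P Q : Expansion I I' F' A' φ),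
    (∀ᶠ y in 𝓝 b, Φ ⟨y, X y⟩ = ⟨φ y, P.eval y⟩) →
    (∀ᶠ y in 𝓝 b, Φ ⟨y, Y y⟩ = ⟨φ y, Q.eval y⟩) →
    Φ ⟨b, (⁅X, Y⁆ : Cₛ^∞⟮I; F, A⟯) b⟩ =
      ⟨φ b, P.bracketAt Q b (LieAlgebroid.anchor F b (X b)) (LieAlgebroid.anchor F b (Y b))⟩

theorem mvfderiv_one (y : N) : mvfderiv K (1 : C^∞⟮K, N; 𝓘(ℝ, ℝ), ℝ⟯) y = 0 := by
  have h : mfderiv K 𝓘(ℝ, ℝ) (1 : C^∞⟮K, N; 𝓘(ℝ, ℝ), ℝ⟯) y = 0 := mfderiv_const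
  ext v
  simp only [mvfderiv, h]
  rfl

/-- The pullback `X ∘ ψ` of a section. -/
def Expansion.single (ψ : N → B) (X : Cₛ^∞⟮I; F, A⟯) : Expansion K I F A ψ where
  size := 1
  coeff _ := 1
  sec _ := X

theorem Expansion.single_eval (ψ : N → B) (X : Cₛ^∞⟮I; F, A⟯) (y : N) :
    (Expansion.single (K := K) ψ X).eval y = X (ψ y) := by
  change ∑ _i : Fin 1, (1 : ℝ) • X (ψ y) = _
  simp

theorem Expansion.single_bracketAt [LieAlgebroid I F A] (ψ : N → B) (X Y : Cₛ^∞⟮I; F, A⟯) (y : N)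
    (a b : TangentSpace K y) :
    (Expansion.single (K := K) ψ X).bracketAt (Expansion.single ψ Y) y a b
      = (⁅X, Y⁆ : Cₛ^∞⟮I; F, A⟯) (ψ y) := by
  change ∑ _i : Fin 1, ∑ _j : Fin 1, ((1 : ℝ) * 1) • (⁅X, Y⁆ : Cₛ^∞⟮I; F, A⟯) (ψ y)
    + ∑ _j : Fin 1, (mvfderiv K (1 : C^∞⟮K, N; 𝓘(ℝ, ℝ), ℝ⟯) y a) • Y (ψ y)
    - ∑ _i : Fin 1, (mvfderiv K (1 : C^∞⟮K, N; 𝓘(ℝ, ℝ), ℝ⟯) y b) • X (ψ y) = _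
  simp only [mvfderiv_one]
  simp

theorem IsLieAlgebroidMorphism.map_bracket [LieAlgebroid I F A] [LieAlgebroid I' F' A']
    {φ : B → B'} {Φ : TotalSpace F A → TotalSpace F' A'} (h : IsLieAlgebroidMorphism I I' φ Φ)
    {X Y : Cₛ^∞⟮I; F, A⟯} {X' Y' : Cₛ^∞⟮I'; F', A'⟯}
    (hX : ∀ b, Φ ⟨b, X b⟩ = ⟨φ b, X' (φ b)⟩) (hY : ∀ b, Φ ⟨b, Y b⟩ = ⟨φ b, Y' (φ b)⟩) (b : B) :
    Φ ⟨b, (⁅X, Y⁆ : Cₛ^∞⟮I; F, A⟯) b⟩ = ⟨φ b, (⁅X', Y'⁆ : Cₛ^∞⟮I'; F', A'⟯) (φ b)⟩ := by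
  have := h.bracket X Y b (Expansion.single φ X') (Expansion.single φ Y')
    (.of_forall fun y ↦ by rw [hX, Expansion.single_eval])
    (.of_forall fun y ↦ by rw [hY, Expansion.single_eval])
  rw [this, Expansion.single_bracketAt]

end LieAlgebroid

/-! ### VB-groupoids and LA-groupoids -/

section Groupoids

variable {EG HG EM HM : Type*}
  [NormedAddCommGroup EG] [NormedSpace ℝ EG] [TopologicalSpace HG]
  [NormedAddCommGroup EM] [NormedSpace ℝ EM] [TopologicalSpace HM]
  {I : ModelWithCorners ℝ EG HG} {J : ModelWithCorners ℝ EM HM}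
  {G M : Type*}
  [TopologicalSpace G] [ChartedSpace HG G] [IsManifold I ∞ G]
  [TopologicalSpace M] [ChartedSpace HM M] [IsManifold J ∞ M]
  (𝒢 : LieGroupoid I J G M)
  (FV : Type*) [NormedAddCommGroup FV] [NormedSpace ℝ FV]
  (V : G → Type*) [TopologicalSpace (TotalSpace FV V)]
  [∀ g, AddCommGroup (V g)] [∀ g, Module ℝ (V g)] [∀ g, TopologicalSpace (V g)]
  [FiberBundle FV V] [VectorBundle ℝ FV V] [ContMDiffVectorBundle ∞ FV V I]
  (FE : Type*) [NormedAddCommGroup FE] [NormedSpace ℝ FE]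
  (E : M → Type*) [TopologicalSpace (TotalSpace FE E)]
  [∀ x, AddCommGroup (E x)] [∀ x, Module ℝ (E x)] [∀ x, TopologicalSpace (E x)]
  [FiberBundle FE E] [VectorBundle ℝ FE E] [ContMDiffVectorBundle ∞ FE E J]

/-- A VB-groupoid `V ⇉ E` over the Lie groupoid `G ⇉ M`: a Lie groupoid structure on the total
spaces of the vector bundles `V → G` and `E → M`, all of whose structure maps are vector bundle
maps over the corresponding structure maps of `G ⇉ M`.  For the multiplication this says that over
each composable pair `(g, h)` it is the restriction, to the space of composable pairs in
`V g × V h`, of a linear map to `V (g h)`; a linear map on that subspace always extends. -/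
structure VBGroupoid extends
    LieGroupoid (I.prod 𝓘(ℝ, FV)) (J.prod 𝓘(ℝ, FE)) (TotalSpace FV V) (TotalSpace FE E) where
  linear_src : IsFiberwiseLinear 𝒢.src src
  linear_tgt : IsFiberwiseLinear 𝒢.tgt tgt
  linear_one : IsFiberwiseLinear 𝒢.one one
  linear_inv : IsFiberwiseLinear 𝒢.inv inv
  linear_mul : ∀ g h, 𝒢.src g = 𝒢.tgt h → ∃ L : V g × V h →ₗ[ℝ] V (𝒢.mul g h),
    ∀ (v : V g) (w : V h), src ⟨g, v⟩ = tgt ⟨h, w⟩ →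
      mul ⟨g, v⟩ ⟨h, w⟩ = ⟨𝒢.mul g h, L (v, w)⟩

/-- The multiplication `V⁽²⁾ = V ×_E V → V` is a morphism of Lie algebroids over the multiplication
`G⁽²⁾ → G`.  Here `V⁽²⁾ → G⁽²⁾` carries the fibre product Lie algebroid structure, i.e. that of a
Lie subalgebroid of `V × V → G × G`: the anchor is `(v, w) ↦ (ρ(v), ρ(w)) ∈ T G⁽²⁾ ⊆ TG × TG`, and
the bracket is computed componentwise, by the Leibniz rule, for sections written near a point of
`G⁽²⁾` as `(∑ᵢ fᵢ (Xᵢ ∘ pr₁), ∑ₖ f'ₖ (X'ₖ ∘ pr₂))`.  Functions on `G⁽²⁾` are represented by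
functions on `G × G`. -/
structure VBGroupoid.MulIsLieAlgebroidMorphism {𝒢 : LieGroupoid I J G M} {FV : Type*}
    [NormedAddCommGroup FV] [NormedSpace ℝ FV]
    {V : G → Type*} [TopologicalSpace (TotalSpace FV V)]
    [∀ g, AddCommGroup (V g)] [∀ g, Module ℝ (V g)] [∀ g, TopologicalSpace (V g)]
    [FiberBundle FV V] [VectorBundle ℝ FV V] [ContMDiffVectorBundle ∞ FV V I]
    {FE : Type*} [NormedAddCommGroup FE] [NormedSpace ℝ FE]
    {E : M → Type*} [TopologicalSpace (TotalSpace FE E)]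
    [∀ x, AddCommGroup (E x)] [∀ x, Module ℝ (E x)] [∀ x, TopologicalSpace (E x)]
    [FiberBundle FE E] [VectorBundle ℝ FE E] [ContMDiffVectorBundle ∞ FE E J]
    [LieAlgebroid I FV V]
    (𝒱 : VBGroupoid 𝒢 FV V FE E) : Prop where
  /-- `dm (ρ(v), ρ(w)) = ρ(v w)`, where `dm` is any derivative within `G⁽²⁾`: on vectors tangent
  to `G⁽²⁾` they all agree. -/
  anchor : ∀ (g h : G) (v : V g) (w : V h), 𝒱.src ⟨g, v⟩ = 𝒱.tgt ⟨h, w⟩ →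
    ∀ D : TangentSpace (I.prod I) (g, h) →L[ℝ] TangentSpace I (𝒢.mul g h),
      HasMFDerivWithinAt (I.prod I) I (fun p : G × G ↦ 𝒢.mul p.1 p.2) 𝒢.composable (g, h) D →
      anchorMap (I := I) (𝒱.mul ⟨g, v⟩ ⟨h, w⟩) =
        ⟨𝒢.mul g h, D (LieAlgebroid.anchor (I := I) FV g v, LieAlgebroid.anchor (I := I) FV h w)⟩
  bracket : ∀ p ∈ 𝒢.composable,
    ∀ (P₁ Q₁ : Expansion (I.prod I) I FV V (Prod.fst : G × G → G))
      (P₂ Q₂ : Expansion (I.prod I) I FV V (Prod.snd : G × G → G))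
      (P Q : Expansion (I.prod I) I FV V (fun p : G × G ↦ 𝒢.mul p.1 p.2)),
    (∀ᶠ y in 𝓝[𝒢.composable] p, 𝒱.src ⟨y.1, P₁.eval y⟩ = 𝒱.tgt ⟨y.2, P₂.eval y⟩) →
    (∀ᶠ y in 𝓝[𝒢.composable] p, 𝒱.src ⟨y.1, Q₁.eval y⟩ = 𝒱.tgt ⟨y.2, Q₂.eval y⟩) →
    (∀ᶠ y in 𝓝[𝒢.composable] p,
      𝒱.mul ⟨y.1, P₁.eval y⟩ ⟨y.2, P₂.eval y⟩ = ⟨𝒢.mul y.1 y.2, P.eval y⟩) →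
    (∀ᶠ y in 𝓝[𝒢.composable] p,
      𝒱.mul ⟨y.1, Q₁.eval y⟩ ⟨y.2, Q₂.eval y⟩ = ⟨𝒢.mul y.1 y.2, Q.eval y⟩) →
    ∀ a b : TangentSpace (I.prod I) p,
      a = (LieAlgebroid.anchor (I := I) FV p.1 (P₁.eval p), LieAlgebroid.anchor (I := I) FV p.2 (P₂.eval p)) →
      b = (LieAlgebroid.anchor (I := I) FV p.1 (Q₁.eval p), LieAlgebroid.anchor (I := I) FV p.2 (Q₂.eval p)) →
      𝒱.mul ⟨p.1, P₁.bracketAt Q₁ p a b⟩ ⟨p.2, P₂.bracketAt Q₂ p a b⟩ =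
        ⟨𝒢.mul p.1 p.2, P.bracketAt Q p a b⟩

/-- An LA-groupoid: a VB-groupoid `V ⇉ E` over `G ⇉ M` with Lie algebroid structures on `V → G` and
`E → M`, all of whose structure maps are Lie algebroid morphisms. -/
structure LAGroupoid [LieAlgebroid I FV V] [LieAlgebroid J FE E] extends
    VBGroupoid 𝒢 FV V FE E where
  morphism_src : IsLieAlgebroidMorphism I J 𝒢.src src
  morphism_tgt : IsLieAlgebroidMorphism I J 𝒢.tgt tgt
  morphism_one : IsLieAlgebroidMorphism J I 𝒢.one one
  morphism_inv : IsLieAlgebroidMorphism I I 𝒢.inv inv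
  morphism_mul : toVBGroupoid.MulIsLieAlgebroidMorphism

end Groupoids

/-! ### Multiplicative sections, core sections, invariant sections -/

section MultiplicativeSections

variable {EG HG EM HM : Type*}
  [NormedAddCommGroup EG] [NormedSpace ℝ EG] [TopologicalSpace HG]
  [NormedAddCommGroup EM] [NormedSpace ℝ EM] [TopologicalSpace HM]
  {I : ModelWithCorners ℝ EG HG} {J : ModelWithCorners ℝ EM HM}
  {G M : Type*}
  [TopologicalSpace G] [ChartedSpace HG G] [IsManifold I ∞ G]
  [TopologicalSpace M] [ChartedSpace HM M] [IsManifold J ∞ M]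
  {𝒢 : LieGroupoid I J G M}
  {FV : Type*} [NormedAddCommGroup FV] [NormedSpace ℝ FV]
  {V : G → Type*} [TopologicalSpace (TotalSpace FV V)]
  [∀ g, AddCommGroup (V g)] [∀ g, Module ℝ (V g)] [∀ g, TopologicalSpace (V g)]
  [FiberBundle FV V] [VectorBundle ℝ FV V] [ContMDiffVectorBundle ∞ FV V I]
  {FE : Type*} [NormedAddCommGroup FE] [NormedSpace ℝ FE]
  {E : M → Type*} [TopologicalSpace (TotalSpace FE E)]
  [∀ x, AddCommGroup (E x)] [∀ x, Module ℝ (E x)] [∀ x, TopologicalSpace (E x)]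
  [FiberBundle FE E] [VectorBundle ℝ FE E] [ContMDiffVectorBundle ∞ FE E J]

/-! #### Linear maps between fibres -/

theorem IsFiberwiseLinear.map_zero {B B' F F' : Type*} {A : B → Type*} {A' : B' → Type*}
    [∀ b, AddCommGroup (A b)] [∀ b, Module ℝ (A b)]
    [∀ b, AddCommGroup (A' b)] [∀ b, Module ℝ (A' b)]
    {φ : B → B'} {Φ : TotalSpace F A → TotalSpace F' A'} (h : IsFiberwiseLinear φ Φ) (b : B) :
    Φ ⟨b, 0⟩ = ⟨φ b, 0⟩ := by
  obtain ⟨L, hL⟩ := h b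
  rw [hL, _root_.map_zero]

theorem IsFiberwiseLinear.map_add {B B' F F' : Type*} {A : B → Type*} {A' : B' → Type*}
    [∀ b, AddCommGroup (A b)] [∀ b, Module ℝ (A b)]
    [∀ b, AddCommGroup (A' b)] [∀ b, Module ℝ (A' b)]
    {φ : B → B'} {Φ : TotalSpace F A → TotalSpace F' A'} (h : IsFiberwiseLinear φ Φ)
    {b : B} {v w : A b} {b' : B'} {v' w' : A' b'}
    (hv : Φ ⟨b, v⟩ = ⟨b', v'⟩) (hw : Φ ⟨b, w⟩ = ⟨b', w'⟩) :
    Φ ⟨b, v + w⟩ = ⟨b', v' + w'⟩ := by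
  obtain ⟨L, hL⟩ := h b
  rw [hL] at hv hw
  obtain rfl : φ b = b' := congrArg TotalSpace.proj hv
  rw [TotalSpace.mk_inj] at hv hw
  rw [hL, _root_.map_add, hv, hw]

theorem IsFiberwiseLinear.map_smul {B B' F F' : Type*} {A : B → Type*} {A' : B' → Type*}
    [∀ b, AddCommGroup (A b)] [∀ b, Module ℝ (A b)]
    [∀ b, AddCommGroup (A' b)] [∀ b, Module ℝ (A' b)]
    {φ : B → B'} {Φ : TotalSpace F A → TotalSpace F' A'} (h : IsFiberwiseLinear φ Φ)
    {b : B} {v : A b} {b' : B'} {v' : A' b'} (a : ℝ)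
    (hv : Φ ⟨b, v⟩ = ⟨b', v'⟩) : Φ ⟨b, a • v⟩ = ⟨b', a • v'⟩ := by
  obtain ⟨L, hL⟩ := h b
  rw [hL] at hv
  obtain rfl : φ b = b' := congrArg TotalSpace.proj hv
  rw [TotalSpace.mk_inj] at hv
  rw [hL, _root_.map_smul, hv]

namespace VBGroupoid

variable (𝒱 : VBGroupoid 𝒢 FV V FE E)

theorem mul_add {g h k : G} (hgh : 𝒢.src g = 𝒢.tgt h) {v v' : V g} {w w' : V h} {u u' : V k}
    (hc : 𝒱.src ⟨g, v⟩ = 𝒱.tgt ⟨h, w⟩) (hc' : 𝒱.src ⟨g, v'⟩ = 𝒱.tgt ⟨h, w'⟩)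
    (hu : 𝒱.mul ⟨g, v⟩ ⟨h, w⟩ = ⟨k, u⟩) (hu' : 𝒱.mul ⟨g, v'⟩ ⟨h, w'⟩ = ⟨k, u'⟩) :
    𝒱.mul ⟨g, v + v'⟩ ⟨h, w + w'⟩ = ⟨k, u + u'⟩ := by
  obtain ⟨L, hL⟩ := 𝒱.linear_mul g h hgh
  obtain ⟨S, hS⟩ := 𝒱.linear_src g
  have hc'' : 𝒱.src ⟨g, v + v'⟩ = 𝒱.tgt ⟨h, w + w'⟩ := by
    rw [𝒱.linear_src.map_add (hS v) (hS v'),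
      𝒱.linear_tgt.map_add (hc.symm.trans (hS v)) (hc'.symm.trans (hS v'))]
  rw [hL _ _ hc] at hu
  rw [hL _ _ hc'] at hu'
  obtain rfl : 𝒢.mul g h = k := congrArg TotalSpace.proj hu
  rw [TotalSpace.mk_inj] at hu hu'
  rw [hL _ _ hc'', ← Prod.mk_add_mk, map_add, hu, hu']

theorem mul_smul {g h k : G} (hgh : 𝒢.src g = 𝒢.tgt h) {v : V g} {w : V h} {u : V k} (a : ℝ)
    (hc : 𝒱.src ⟨g, v⟩ = 𝒱.tgt ⟨h, w⟩) (hu : 𝒱.mul ⟨g, v⟩ ⟨h, w⟩ = ⟨k, u⟩) :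
    𝒱.mul ⟨g, a • v⟩ ⟨h, a • w⟩ = ⟨k, a • u⟩ := by
  obtain ⟨L, hL⟩ := 𝒱.linear_mul g h hgh
  obtain ⟨S, hS⟩ := 𝒱.linear_src g
  have hc'' : 𝒱.src ⟨g, a • v⟩ = 𝒱.tgt ⟨h, a • w⟩ := by
    rw [𝒱.linear_src.map_smul a (hS v), 𝒱.linear_tgt.map_smul a (hc.symm.trans (hS v))]
  rw [hL _ _ hc] at hu
  obtain rfl : 𝒢.mul g h = k := congrArg TotalSpace.proj hu
  rw [TotalSpace.mk_inj] at hu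
  rw [hL _ _ hc'', ← Prod.smul_mk, _root_.map_smul, hu]

theorem mul_zero_zero {g h : G} (hgh : 𝒢.src g = 𝒢.tgt h) :
    𝒱.mul ⟨g, 0⟩ ⟨h, 0⟩ = ⟨𝒢.mul g h, 0⟩ := by
  obtain ⟨L, hL⟩ := 𝒱.linear_mul g h hgh
  rw [hL, Prod.mk_zero_zero, map_zero]
  rw [𝒱.linear_src.map_zero, 𝒱.linear_tgt.map_zero, hgh]

theorem mul_proj {v w : TotalSpace FV V} (h : 𝒱.src v = 𝒱.tgt w) :
    (𝒱.mul v w).proj = 𝒢.mul v.proj w.proj := by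
  obtain ⟨g, v⟩ := v
  obtain ⟨k, w⟩ := w
  obtain ⟨S, hS⟩ := 𝒱.linear_src g
  obtain ⟨T, hT⟩ := 𝒱.linear_tgt k
  have hgk : 𝒢.src g = 𝒢.tgt k := by
    have := congrArg TotalSpace.proj h
    rwa [hS, hT] at this
  obtain ⟨L, hL⟩ := 𝒱.linear_mul g k hgk
  rw [hL v w h]

/-! #### Multiplicative sections -/

/-- A section `X` of `V → G` is multiplicative if it is a morphism of Lie groupoids covering some
section `e` of `E → M`. -/
def IsMultiplicative (X : Cₛ^∞⟮I; FV, V⟯) : Prop :=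
  ∃ e : Cₛ^∞⟮J; FE, E⟯, 𝒢.IsMorphism 𝒱.toLieGroupoid
    (fun g ↦ (⟨g, X g⟩ : TotalSpace FV V)) (fun x ↦ (⟨x, e x⟩ : TotalSpace FE E))

/-! #### Sections of the core -/

/-- Smooth sections of the core `C = ker(src)|_M`: smooth maps `c : M → V` with `c x` in the fibre
of `V` over the unit at `x` and `src (c x) = 0`. -/
def coreSections : Submodule ℝ (∀ x : M, V (𝒢.one x)) where
  carrier := {c | ContMDiff J (I.prod 𝓘(ℝ, FV)) ∞
      (fun x ↦ (⟨𝒢.one x, c x⟩ : TotalSpace FV V)) ∧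
    ∀ x, 𝒱.src ⟨𝒢.one x, c x⟩ = ⟨x, 0⟩}
  add_mem' := by
    rintro c d ⟨hc, hc'⟩ ⟨hd, hd'⟩
    refine ⟨fun x₀ ↦ ?_, fun x ↦ ?_⟩
    · have h₁ := (contMDiffAt_totalSpace.1 (hc x₀)).2
      have h₂ := (contMDiffAt_totalSpace.1 (hd x₀)).2
      refine contMDiffAt_totalSpace.2 ⟨𝒢.contMDiff_one x₀, (h₁.add h₂).congr_of_eventuallyEq ?_⟩
      have hnhds : ∀ᶠ x in 𝓝 x₀, 𝒢.one x ∈ (trivializationAt FV V (𝒢.one x₀)).baseSet :=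
        𝒢.contMDiff_one.continuous.continuousAt.eventually
          ((trivializationAt FV V (𝒢.one x₀)).open_baseSet.mem_nhds
            (mem_baseSet_trivializationAt FV V _))
      filter_upwards [hnhds] with x hx
      exact ((trivializationAt FV V (𝒢.one x₀)).linear ℝ hx).map_add (c x) (d x)
    · simpa using 𝒱.linear_src.map_add (hc' x) (hd' x)
  zero_mem' :=
    ⟨((contMDiff_zeroSection ℝ V).of_le le_top).comp 𝒢.contMDiff_one,
      fun x ↦ (𝒱.linear_src.map_zero _).trans (by rw [𝒢.src_one])⟩
  smul_mem' := by
    rintro a c ⟨hc, hc'⟩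
    refine ⟨fun x₀ ↦ ?_, fun x ↦ ?_⟩
    · have h₁ := (contMDiffAt_totalSpace.1 (hc x₀)).2
      refine contMDiffAt_totalSpace.2 ⟨𝒢.contMDiff_one x₀,
        ((contMDiffAt_const (I' := 𝓘(ℝ, ℝ)) (c := a)).smul h₁).congr_of_eventuallyEq ?_⟩
      have hnhds : ∀ᶠ x in 𝓝 x₀, 𝒢.one x ∈ (trivializationAt FV V (𝒢.one x₀)).baseSet :=
        𝒢.contMDiff_one.continuous.continuousAt.eventually
          ((trivializationAt FV V (𝒢.one x₀)).open_baseSet.mem_nhds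
            (mem_baseSet_trivializationAt FV V _))
      filter_upwards [hnhds] with x hx
      exact ((trivializationAt FV V (𝒢.one x₀)).linear ℝ hx).map_smul a (c x)
    · simpa using 𝒱.linear_src.map_smul a (hc' x)

variable (c : 𝒱.coreSections)

theorem core_src (x : M) : 𝒱.src ⟨𝒢.one x, c.1 x⟩ = ⟨x, 0⟩ := c.2.2 x

theorem core_right_composable (g : G) :
    𝒱.src ⟨𝒢.one (𝒢.tgt g), c.1 (𝒢.tgt g)⟩ = 𝒱.tgt ⟨g, 0⟩ := by
  rw [core_src, 𝒱.linear_tgt.map_zero]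

theorem core_left_composable (g : G) :
    𝒱.src ⟨g, 0⟩ = 𝒱.tgt (𝒱.inv ⟨𝒢.one (𝒢.src g), c.1 (𝒢.src g)⟩) := by
  rw [𝒱.tgt_inv, core_src, 𝒱.linear_src.map_zero]

theorem inv_one (x : M) : 𝒢.inv (𝒢.one x) = 𝒢.one x := by
  have h₁ := 𝒢.inv_mul (𝒢.one x)
  have h₂ := 𝒢.mul_one (𝒢.inv (𝒢.one x))
  rw [𝒢.src_inv, 𝒢.tgt_one] at h₂
  rw [h₂, 𝒢.src_one] at h₁
  exact h₁

/-- The right invariant section `c^r(g) = c(t(g)) · 0_g`. -/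
def rightInvariant : Cₛ^∞⟮I; FV, V⟯ :=
  sectionOfMap (fun g ↦ 𝒱.mul ⟨𝒢.one (𝒢.tgt g), c.1 (𝒢.tgt g)⟩ ⟨g, 0⟩)
    (by
      have h₁ : ContMDiff I (I.prod 𝓘(ℝ, FV)) ∞
          (fun g ↦ (⟨𝒢.one (𝒢.tgt g), c.1 (𝒢.tgt g)⟩ : TotalSpace FV V)) :=
        c.2.1.comp 𝒢.contMDiff_tgt
      have h₂ : ContMDiff I (I.prod 𝓘(ℝ, FV)) ∞ (fun g ↦ (⟨g, 0⟩ : TotalSpace FV V)) :=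
        (contMDiff_zeroSection ℝ V).of_le le_top
      exact 𝒱.contMDiffOn_mul.comp_contMDiff (h₁.prodMk h₂) (𝒱.core_right_composable c))
    (fun g ↦ by rw [𝒱.mul_proj (𝒱.core_right_composable c g)]; exact 𝒢.one_mul g)

theorem rightInvariant_spec (g : G) : (⟨g, 𝒱.rightInvariant c g⟩ : TotalSpace FV V) =
    𝒱.mul ⟨𝒢.one (𝒢.tgt g), c.1 (𝒢.tgt g)⟩ ⟨g, 0⟩ :=
  sectionOfMap_spec _ _ _ g

/-- The left invariant section `c^l(g) = - 0_g · c(s(g))⁻¹`. -/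
def leftInvariant : Cₛ^∞⟮I; FV, V⟯ :=
  - sectionOfMap (fun g ↦ 𝒱.mul ⟨g, 0⟩ (𝒱.inv ⟨𝒢.one (𝒢.src g), c.1 (𝒢.src g)⟩))
    (by
      have h₁ : ContMDiff I (I.prod 𝓘(ℝ, FV)) ∞
          (fun g ↦ 𝒱.inv (⟨𝒢.one (𝒢.src g), c.1 (𝒢.src g)⟩ : TotalSpace FV V)) :=
        𝒱.contMDiff_inv.comp (c.2.1.comp 𝒢.contMDiff_src)
      have h₂ : ContMDiff I (I.prod 𝓘(ℝ, FV)) ∞ (fun g ↦ (⟨g, 0⟩ : TotalSpace FV V)) :=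
        (contMDiff_zeroSection ℝ V).of_le le_top
      exact 𝒱.contMDiffOn_mul.comp_contMDiff (h₂.prodMk h₁) (𝒱.core_left_composable c))
    (fun g ↦ by
      rw [𝒱.mul_proj (𝒱.core_left_composable c g)]
      obtain ⟨L, hL⟩ := 𝒱.linear_inv (𝒢.one (𝒢.src g))
      rw [hL]
      change 𝒢.mul g (𝒢.inv (𝒢.one (𝒢.src g))) = g
      rw [inv_one, 𝒢.mul_one])

theorem rightInvariant_one (x : M) : 𝒱.rightInvariant c (𝒢.one x) = c.1 x := by
  have h := 𝒱.rightInvariant_spec c (𝒢.one x)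
  have h₁ : (⟨𝒢.one x, 0⟩ : TotalSpace FV V) = 𝒱.one ⟨x, 0⟩ := (𝒱.linear_one.map_zero x).symm
  rw [𝒢.tgt_one, h₁, ← 𝒱.core_src c x, 𝒱.mul_one, TotalSpace.mk_inj] at h
  exact h

theorem rightInvariant_injective : Function.Injective 𝒱.rightInvariant := by
  intro c d h
  refine Subtype.ext (funext fun x ↦ ?_)
  rw [← rightInvariant_one, h, rightInvariant_one]

theorem rightInvariant_add (c d : 𝒱.coreSections) :
    𝒱.rightInvariant (c + d) = 𝒱.rightInvariant c + 𝒱.rightInvariant d := by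
  refine ContMDiffSection.ext fun g ↦ ?_
  have h := 𝒱.mul_add (𝒢.src_one _) (𝒱.core_right_composable c g) (𝒱.core_right_composable d g)
    (𝒱.rightInvariant_spec c g).symm (𝒱.rightInvariant_spec d g).symm
  rw [add_zero] at h
  have h' := (𝒱.rightInvariant_spec (c + d) g).trans h
  rw [TotalSpace.mk_inj] at h'
  exact h'

theorem rightInvariant_smul (a : ℝ) (c : 𝒱.coreSections) :
    𝒱.rightInvariant (a • c) = a • 𝒱.rightInvariant c := by
  refine ContMDiffSection.ext fun g ↦ ?_
  have h := 𝒱.mul_smul (𝒢.src_one _) a (𝒱.core_right_composable c g)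
    (𝒱.rightInvariant_spec c g).symm
  rw [smul_zero] at h
  have h' := (𝒱.rightInvariant_spec (a • c) g).trans h
  rw [TotalSpace.mk_inj] at h'
  exact h'

theorem src_rightInvariant (g : G) :
    𝒱.src ⟨g, 𝒱.rightInvariant c g⟩ = ⟨𝒢.src g, 0⟩ := by
  rw [rightInvariant_spec, 𝒱.src_mul _ _ (𝒱.core_right_composable c g), 𝒱.linear_src.map_zero]

theorem rightInvariant_mul {g h : G} (hgh : 𝒢.src g = 𝒢.tgt h) :
    𝒱.mul ⟨g, 𝒱.rightInvariant c g⟩ ⟨h, 0⟩ =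
      ⟨𝒢.mul g h, 𝒱.rightInvariant c (𝒢.mul g h)⟩ := by
  rw [rightInvariant_spec, 𝒱.mul_assoc _ _ _ (𝒱.core_right_composable c g)
    (by rw [𝒱.linear_src.map_zero, 𝒱.linear_tgt.map_zero, hgh]), 𝒱.mul_zero_zero hgh,
    rightInvariant_spec, 𝒢.tgt_mul g h hgh]

end VBGroupoid

/-! #### The Lie algebras of multiplicative sections and of core sections -/

namespace LAGroupoid

variable [LieAlgebroid I FV V] [LieAlgebroid J FE E]

theorem mul_bracket (𝒱 : LAGroupoid 𝒢 FV V FE E) {X₁ X₂ X Y₁ Y₂ Y : Cₛ^∞⟮I; FV, V⟯}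
    (hX : ∀ g h, 𝒢.src g = 𝒢.tgt h → 𝒱.src ⟨g, X₁ g⟩ = 𝒱.tgt ⟨h, X₂ h⟩)
    (hY : ∀ g h, 𝒢.src g = 𝒢.tgt h → 𝒱.src ⟨g, Y₁ g⟩ = 𝒱.tgt ⟨h, Y₂ h⟩)
    (hX' : ∀ g h, 𝒢.src g = 𝒢.tgt h →
      𝒱.mul ⟨g, X₁ g⟩ ⟨h, X₂ h⟩ = ⟨𝒢.mul g h, X (𝒢.mul g h)⟩)
    (hY' : ∀ g h, 𝒢.src g = 𝒢.tgt h →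
      𝒱.mul ⟨g, Y₁ g⟩ ⟨h, Y₂ h⟩ = ⟨𝒢.mul g h, Y (𝒢.mul g h)⟩)
    {g h : G} (hgh : 𝒢.src g = 𝒢.tgt h) :
    𝒱.mul ⟨g, (⁅X₁, Y₁⁆ : Cₛ^∞⟮I; FV, V⟯) g⟩ ⟨h, (⁅X₂, Y₂⁆ : Cₛ^∞⟮I; FV, V⟯) h⟩ =
      ⟨𝒢.mul g h, (⁅X, Y⁆ : Cₛ^∞⟮I; FV, V⟯) (𝒢.mul g h)⟩ := by
  have H := 𝒱.morphism_mul.bracket (g, h) hgh (.single _ X₁) (.single _ Y₁)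
    (.single _ X₂) (.single _ Y₂) (.single _ X) (.single _ Y)
    (eventually_mem_nhdsWithin.mono fun y hy ↦ by
      simp only [Expansion.single_eval]; exact hX _ _ hy)
    (eventually_mem_nhdsWithin.mono fun y hy ↦ by
      simp only [Expansion.single_eval]; exact hY _ _ hy)
    (eventually_mem_nhdsWithin.mono fun y hy ↦ by
      simp only [Expansion.single_eval]; exact hX' _ _ hy)
    (eventually_mem_nhdsWithin.mono fun y hy ↦ by
      simp only [Expansion.single_eval]; exact hY' _ _ hy)
  have H' := fun a b ha hb ↦ H a b ha hb
  simp only [Expansion.single_bracketAt] at H'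
  exact H' _ _ rfl rfl

variable (𝒱 : LAGroupoid 𝒢 FV V FE E)

/-- The multiplicative sections form a Lie subalgebra `Γ_mult(V)` of `Γ(V)`. -/
def multiplicativeSections : LieSubalgebra ℝ Cₛ^∞⟮I; FV, V⟯ where
  carrier := {X | 𝒱.IsMultiplicative X}
  add_mem' := by
    rintro X Y ⟨e, he⟩ ⟨f, hf⟩
    refine ⟨e + f, ⟨(X + Y).contMDiff, (e + f).contMDiff, fun g ↦ ?_, fun g ↦ ?_, fun x ↦ ?_,
      fun g h hgh ↦ ?_⟩⟩
    · exact 𝒱.linear_src.map_add (he.src g) (hf.src g)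
    · exact 𝒱.linear_tgt.map_add (he.tgt g) (hf.tgt g)
    · exact (𝒱.linear_one.map_add (he.one x).symm (hf.one x).symm).symm
    · refine (𝒱.mul_add hgh ?_ ?_ (he.mul g h hgh).symm (hf.mul g h hgh).symm).symm
      · rw [he.src g, he.tgt h, hgh]
      · rw [hf.src g, hf.tgt h, hgh]
  zero_mem' := by
    refine ⟨0, ⟨(0 : Cₛ^∞⟮I; FV, V⟯).contMDiff, (0 : Cₛ^∞⟮J; FE, E⟯).contMDiff, fun g ↦ ?_,
      fun g ↦ ?_, fun x ↦ ?_, fun g h hgh ↦ ?_⟩⟩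
    · exact 𝒱.linear_src.map_zero g
    · exact 𝒱.linear_tgt.map_zero g
    · exact (𝒱.linear_one.map_zero x).symm
    · exact (𝒱.mul_zero_zero hgh).symm
  smul_mem' := by
    rintro a X ⟨e, he⟩
    refine ⟨a • e, ⟨(a • X).contMDiff, (a • e).contMDiff, fun g ↦ ?_, fun g ↦ ?_, fun x ↦ ?_,
      fun g h hgh ↦ ?_⟩⟩
    · exact 𝒱.linear_src.map_smul a (he.src g)
    · exact 𝒱.linear_tgt.map_smul a (he.tgt g)
    · exact (𝒱.linear_one.map_smul a (he.one x).symm).symm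
    · refine (𝒱.mul_smul hgh a ?_ (he.mul g h hgh).symm).symm
      rw [he.src g, he.tgt h, hgh]
  lie_mem' := by
    rintro X Y ⟨e, he⟩ ⟨f, hf⟩
    refine ⟨⁅e, f⁆, ⟨(⁅X, Y⁆ : Cₛ^∞⟮I; FV, V⟯).contMDiff, (⁅e, f⁆ : Cₛ^∞⟮J; FE, E⟯).contMDiff,
      fun g ↦ ?_, fun g ↦ ?_, fun x ↦ ?_, fun g h hgh ↦ ?_⟩⟩
    · exact 𝒱.morphism_src.map_bracket he.src hf.src g
    · exact 𝒱.morphism_tgt.map_bracket he.tgt hf.tgt g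
    · exact (𝒱.morphism_one.map_bracket (fun x ↦ (he.one x).symm)
        (fun x ↦ (hf.one x).symm) x).symm
    · exact (𝒱.mul_bracket (fun g h hgh ↦ by rw [he.src g, he.tgt h, hgh])
        (fun g h hgh ↦ by rw [hf.src g, hf.tgt h, hgh])
        (fun g h hgh ↦ (he.mul g h hgh).symm) (fun g h hgh ↦ (hf.mul g h hgh).symm) hgh).symm

/-- The bracket of core sections: the restriction to the units of the bracket of the corresponding
right invariant sections. -/
def coreBracket (c d : 𝒱.coreSections) : 𝒱.coreSections :=
  ⟨fun x ↦ (⁅𝒱.rightInvariant c, 𝒱.rightInvariant d⁆ : Cₛ^∞⟮I; FV, V⟯) (𝒢.one x),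
    (⁅𝒱.rightInvariant c, 𝒱.rightInvariant d⁆ : Cₛ^∞⟮I; FV, V⟯).contMDiff.comp 𝒢.contMDiff_one,
    fun x ↦ by
      have h := 𝒱.morphism_src.map_bracket (X := 𝒱.rightInvariant c) (Y := 𝒱.rightInvariant d)
        (X' := 0) (Y' := 0) (𝒱.src_rightInvariant c) (𝒱.src_rightInvariant d) (𝒢.one x)
      rw [lie_zero, 𝒢.src_one] at h
      exact h⟩

/-- The bracket of core sections is characterized by `[c, d]^r = [c^r, d^r]`. -/
theorem rightInvariant_coreBracket (c d : 𝒱.coreSections) :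
    𝒱.rightInvariant (𝒱.coreBracket c d) = ⁅𝒱.rightInvariant c, 𝒱.rightInvariant d⁆ := by
  refine ContMDiffSection.ext fun g ↦ ?_
  have hz : ∀ (c : 𝒱.coreSections) (g h : G), 𝒢.src g = 𝒢.tgt h →
      𝒱.src ⟨g, 𝒱.rightInvariant c g⟩ = 𝒱.tgt ⟨h, (0 : Cₛ^∞⟮I; FV, V⟯) h⟩ := fun c g h hgh ↦ by
    rw [𝒱.src_rightInvariant, hgh]
    exact (𝒱.linear_tgt.map_zero h).symm
  have h := 𝒱.mul_bracket (hz c) (hz d) (fun _ _ h ↦ 𝒱.rightInvariant_mul c h)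
    (fun _ _ h ↦ 𝒱.rightInvariant_mul d h) (𝒢.src_one (𝒢.tgt g))
  rw [lie_zero, 𝒢.one_mul] at h
  have h' := (𝒱.rightInvariant_spec (𝒱.coreBracket c d) g).trans h
  rw [TotalSpace.mk_inj] at h'
  exact h'

/-- The Lie ring `Γ(C)` of sections of the core. -/
instance instLieRingCore : LieRing 𝒱.coreSections where
  bracket := 𝒱.coreBracket
  add_lie c d e := 𝒱.rightInvariant_injective (by
    simp only [𝒱.rightInvariant_add, rightInvariant_coreBracket, add_lie])
  lie_add c d e := 𝒱.rightInvariant_injective (by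
    simp only [𝒱.rightInvariant_add, rightInvariant_coreBracket, lie_add])
  lie_self c := 𝒱.rightInvariant_injective (by
    rw [rightInvariant_coreBracket, lie_self, ← zero_smul ℝ (0 : 𝒱.coreSections),
      𝒱.rightInvariant_smul, zero_smul])
  leibniz_lie c d e := 𝒱.rightInvariant_injective (by
    simp only [𝒱.rightInvariant_add, rightInvariant_coreBracket]
    exact leibniz_lie _ _ _)

/-- The real Lie algebra `Γ(C)` of sections of the core. -/
instance instLieAlgebraCore : LieAlgebra ℝ 𝒱.coreSections where
  lie_smul a c d := 𝒱.rightInvariant_injective (by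
    change 𝒱.rightInvariant (𝒱.coreBracket c (a • d)) =
      𝒱.rightInvariant (a • 𝒱.coreBracket c d)
    simp only [𝒱.rightInvariant_smul, rightInvariant_coreBracket, lie_smul])

end LAGroupoid

end MultiplicativeSections

/-! ### Crossed modules of Lie algebras -/

/-- A crossed module of Lie algebras `𝔤 → 𝔥 → Der(𝔤)`. -/
structure LieCrossedModule (R 𝔤 𝔥 : Type*) [CommRing R] [LieRing 𝔤] [LieAlgebra R 𝔤]
    [LieRing 𝔥] [LieAlgebra R 𝔥] where
  bd : 𝔤 →ₗ⁅R⁆ 𝔥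
  act : 𝔥 →ₗ⁅R⁆ LieDerivation R 𝔤 𝔤
  act_bd : ∀ u v : 𝔤, act (bd u) v = ⁅u, v⁆
  bd_act : ∀ (X : 𝔥) (u : 𝔤), bd (act X u) = ⁅X, bd u⁆

end

/-! A section is determined by what it is related to, and every bracket needed here is a bracket of
related sections. For the multiplication, write (X₁, X₂) → X when the product of X₁(g) and X₂(h) is
X(gh) on all composable pairs. Since the multiplication of `𝒱` is a Lie algebroid morphism, (X₁, X₂)
→ X and (Y₁, Y₂) → Y give ([X₁, Y₁], [X₂, Y₂]) → [X, Y]. The sections that occur satisfy (X, X) → X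
for X multiplicative, (c^r, 0) → c^r and (0, c^l) → c^l. Pairing them shows that [X, c^r] and [c^r,
d^r] are again right invariant, and that [c^r, d^l] is the product of two zero vectors, hence zero.
The inversion is also a Lie algebroid morphism. It relates c^r to -c^l and a multiplicative section
to itself, so each formula for right invariant sections yields one for left invariant sections: [c,
d]^l = -[c^l, d^l] and (D_X c)^l = [X, c^l]. The section c^r - c^l is multiplicative because its
value at g is c(t(g)) · 0_g · c(s(g))⁻¹, and the inner factors cancel in a product of two such
values. Finally c ↦ c^r is injective and linear, so every identity in Γ(C), including the Leibniz
rule and the Peiffer identity, is checked in Γ(V), where it follows from the Jacobi identity and the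
commutation of c^r with d^l. -/

namespace LieGroupoid

variable {EG HG EM HM : Type*}
  [NormedAddCommGroup EG] [NormedSpace ℝ EG] [TopologicalSpace HG]
  [NormedAddCommGroup EM] [NormedSpace ℝ EM] [TopologicalSpace HM]
  {I : ModelWithCorners ℝ EG HG} {J : ModelWithCorners ℝ EM HM}
  {G M : Type*}
  [TopologicalSpace G] [ChartedSpace HG G] [TopologicalSpace M] [ChartedSpace HM M]
  (𝒢 : LieGroupoid I J G M)

/-! ### Inverses in a Lie groupoid; used both for the base `𝒢` and for the total space `𝒱`. -/

theorem inv_mul_cancel_left {g h : G} (hgh : 𝒢.src g = 𝒢.tgt h) :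
    𝒢.mul (𝒢.inv g) (𝒢.mul g h) = h := by
  rw [← 𝒢.mul_assoc _ _ _ (𝒢.src_inv g) hgh, 𝒢.inv_mul, hgh, 𝒢.one_mul]

/-- Cancelling g on the left shows that a right inverse is the inverse. The identities for inverses
below all reduce to this uniqueness. -/
theorem eq_inv_of_mul_eq_one {g h : G} (hgh : 𝒢.src g = 𝒢.tgt h)
    (h1 : 𝒢.mul g h = 𝒢.one (𝒢.tgt g)) : h = 𝒢.inv g := by
  rw [← 𝒢.inv_mul_cancel_left hgh, h1, ← 𝒢.src_inv g, 𝒢.mul_one]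

theorem inv_inv (g : G) : 𝒢.inv (𝒢.inv g) = g :=
  (𝒢.eq_inv_of_mul_eq_one (𝒢.src_inv g) (by rw [𝒢.inv_mul, 𝒢.tgt_inv])).symm

theorem inv_mul_rev {g h : G} (hgh : 𝒢.src g = 𝒢.tgt h) :
    𝒢.inv (𝒢.mul g h) = 𝒢.mul (𝒢.inv h) (𝒢.inv g) := by
  have hc : 𝒢.src (𝒢.inv h) = 𝒢.tgt (𝒢.inv g) := by rw [𝒢.src_inv, 𝒢.tgt_inv, hgh]
  refine (𝒢.eq_inv_of_mul_eq_one ?_ ?_).symm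
  · rw [𝒢.src_mul g h hgh, 𝒢.tgt_mul _ _ hc, 𝒢.tgt_inv]
  · rw [𝒢.mul_assoc _ _ _ hgh (by rw [𝒢.tgt_mul _ _ hc, 𝒢.tgt_inv]),
      ← 𝒢.mul_assoc _ _ _ (𝒢.tgt_inv h).symm hc, 𝒢.mul_inv, ← hgh, ← 𝒢.tgt_inv g, 𝒢.one_mul,
      𝒢.mul_inv, 𝒢.tgt_mul g h hgh]

/-- A morphism of Lie groupoids commutes with the inversions. -/
theorem IsMorphism.inv {EG' HG' EM' HM' G' M' : Type*}
    [NormedAddCommGroup EG'] [NormedSpace ℝ EG'] [TopologicalSpace HG']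
    [NormedAddCommGroup EM'] [NormedSpace ℝ EM'] [TopologicalSpace HM']
    {I' : ModelWithCorners ℝ EG' HG'} {J' : ModelWithCorners ℝ EM' HM'}
    [TopologicalSpace G'] [ChartedSpace HG' G'] [TopologicalSpace M'] [ChartedSpace HM' M']
    {𝒢 : LieGroupoid I J G M} {𝒢' : LieGroupoid I' J' G' M'} {Φ : G → G'} {φ : M → M'}
    (hΦ : 𝒢.IsMorphism 𝒢' Φ φ) (g : G) : 𝒢'.inv (Φ g) = Φ (𝒢.inv g) := by
  refine (𝒢'.eq_inv_of_mul_eq_one ?_ ?_).symm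
  · rw [hΦ.src, hΦ.tgt, 𝒢.tgt_inv]
  · rw [← hΦ.mul _ _ (𝒢.tgt_inv g).symm, 𝒢.mul_inv, hΦ.one, hΦ.tgt]

end LieGroupoid

section CrossedModule

variable {EG HG EM HM : Type*}
  [NormedAddCommGroup EG] [NormedSpace ℝ EG] [TopologicalSpace HG]
  [NormedAddCommGroup EM] [NormedSpace ℝ EM] [TopologicalSpace HM]
  {I : ModelWithCorners ℝ EG HG} {J : ModelWithCorners ℝ EM HM}
  {G M : Type*}
  [TopologicalSpace G] [ChartedSpace HG G] [IsManifold I ∞ G]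
  [TopologicalSpace M] [ChartedSpace HM M] [IsManifold J ∞ M]
  {𝒢 : LieGroupoid I J G M}
  {FV : Type*} [NormedAddCommGroup FV] [NormedSpace ℝ FV]
  {V : G → Type*} [TopologicalSpace (TotalSpace FV V)]
  [∀ g, AddCommGroup (V g)] [∀ g, Module ℝ (V g)] [∀ g, TopologicalSpace (V g)]
  [FiberBundle FV V] [VectorBundle ℝ FV V] [ContMDiffVectorBundle ∞ FV V I]
  {FE : Type*} [NormedAddCommGroup FE] [NormedSpace ℝ FE]
  {E : M → Type*} [TopologicalSpace (TotalSpace FE E)]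
  [∀ x, AddCommGroup (E x)] [∀ x, Module ℝ (E x)] [∀ x, TopologicalSpace (E x)]
  [FiberBundle FE E] [VectorBundle ℝ FE E] [ContMDiffVectorBundle ∞ FE E J]

/-! ### Left invariant sections, and multiplicativity of c^r - c^l. -/

namespace VBGroupoid

variable (𝒱 : VBGroupoid 𝒢 FV V FE E) (c : 𝒱.coreSections)

/-- The sign in the definition of c^l makes -c^l, not c^l, the bare product 0_g · c(s(g))⁻¹.
Groupoid identities are therefore proved for -c^l and then rescaled. -/
theorem leftInvariant_spec (g : G) : (⟨g, -𝒱.leftInvariant c g⟩ : TotalSpace FV V) =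
    𝒱.mul ⟨g, 0⟩ (𝒱.inv ⟨𝒢.one (𝒢.src g), c.1 (𝒢.src g)⟩) := by
  rw [leftInvariant, ContMDiffSection.coe_neg, Pi.neg_apply, neg_neg]
  exact sectionOfMap_spec _ _ _ g

theorem inv_zero (g : G) : 𝒱.inv ⟨g, 0⟩ = ⟨𝒢.inv g, 0⟩ := 𝒱.linear_inv.map_zero g

/-- Inversion relates `c^r` to `-c^l`. -/
theorem inv_rightInvariant (g : G) :
    𝒱.inv ⟨g, 𝒱.rightInvariant c g⟩ =
      ⟨𝒢.inv g, (-𝒱.leftInvariant c : Cₛ^∞⟮I; FV, V⟯) (𝒢.inv g)⟩ := by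
  rw [ContMDiffSection.coe_neg, Pi.neg_apply, leftInvariant_spec, rightInvariant_spec,
    𝒱.inv_mul_rev (𝒱.core_right_composable c g), inv_zero, 𝒢.src_inv]

/-- Sections that are related to the same section by inversion are equal. -/
theorem eq_of_inv_related {X Y Z : Cₛ^∞⟮I; FV, V⟯}
    (hY : ∀ g, 𝒱.inv ⟨g, X g⟩ = ⟨𝒢.inv g, Y (𝒢.inv g)⟩)
    (hZ : ∀ g, 𝒱.inv ⟨g, X g⟩ = ⟨𝒢.inv g, Z (𝒢.inv g)⟩) : Y = Z := by
  refine ContMDiffSection.ext fun g ↦ ?_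
  have h := (hY (𝒢.inv g)).symm.trans (hZ (𝒢.inv g))
  rw [𝒢.inv_inv, TotalSpace.mk_inj] at h
  exact h

/-- Transported from c ↦ c^r: by linearity of the inversion, the negatives of both sides are related
to (c + d)^r. -/
theorem leftInvariant_add (c d : 𝒱.coreSections) :
    𝒱.leftInvariant (c + d) = 𝒱.leftInvariant c + 𝒱.leftInvariant d := by
  refine neg_injective (𝒱.eq_of_inv_related (𝒱.inv_rightInvariant (c + d)) fun g ↦ ?_)
  rw [rightInvariant_add, neg_add]
  exact 𝒱.linear_inv.map_add (𝒱.inv_rightInvariant c g) (𝒱.inv_rightInvariant d g)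

theorem leftInvariant_smul (a : ℝ) (c : 𝒱.coreSections) :
    𝒱.leftInvariant (a • c) = a • 𝒱.leftInvariant c := by
  refine neg_injective (𝒱.eq_of_inv_related (𝒱.inv_rightInvariant (a • c)) fun g ↦ ?_)
  rw [rightInvariant_smul, ← smul_neg]
  exact 𝒱.linear_inv.map_smul a (𝒱.inv_rightInvariant c g)

theorem tgt_leftInvariant (g : G) :
    𝒱.tgt ⟨g, 𝒱.leftInvariant c g⟩ = ⟨𝒢.tgt g, 0⟩ := by
  have h : 𝒱.tgt ⟨g, -𝒱.leftInvariant c g⟩ = ⟨𝒢.tgt g, 0⟩ := by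
    rw [leftInvariant_spec, 𝒱.tgt_mul _ _ (𝒱.core_left_composable c g), 𝒱.linear_tgt.map_zero]
  -- Scaling by -1 turns the statement for -c^l into the one for c^l.
  simpa using 𝒱.linear_tgt.map_smul (-1) h

/-- Associativity together with 0_g · 0_h = 0_{gh}: this is the relation (0, c^l) → c^l, the mirror
image of `rightInvariant_mul`. -/
theorem mul_leftInvariant {g h : G} (hgh : 𝒢.src g = 𝒢.tgt h) :
    𝒱.mul ⟨g, 0⟩ ⟨h, 𝒱.leftInvariant c h⟩ =
      ⟨𝒢.mul g h, 𝒱.leftInvariant c (𝒢.mul g h)⟩ := by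
  have hz : 𝒱.src ⟨g, 0⟩ = 𝒱.tgt ⟨h, 0⟩ := by
    rw [𝒱.linear_src.map_zero, 𝒱.linear_tgt.map_zero, hgh]
  have hc : 𝒱.src ⟨g, 0⟩ = 𝒱.tgt ⟨h, -𝒱.leftInvariant c h⟩ := by
    rw [leftInvariant_spec, 𝒱.tgt_mul _ _ (𝒱.core_left_composable c h), hz]
  have key : 𝒱.mul ⟨g, 0⟩ ⟨h, -𝒱.leftInvariant c h⟩ =
      ⟨𝒢.mul g h, -𝒱.leftInvariant c (𝒢.mul g h)⟩ := by
    rw [leftInvariant_spec, ← 𝒱.mul_assoc _ _ _ hz (𝒱.core_left_composable c h),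
      𝒱.mul_zero_zero hgh, leftInvariant_spec, 𝒢.src_mul g h hgh]
  simpa using 𝒱.mul_smul hgh (-1) hc key

theorem rightInvariant_inv_composable (g : G) :
    𝒱.src ⟨g, 𝒱.rightInvariant c g⟩ =
      𝒱.tgt (𝒱.inv ⟨𝒢.one (𝒢.src g), c.1 (𝒢.src g)⟩) := by
  rw [src_rightInvariant, 𝒱.tgt_inv, core_src]

/-- `c^r(g) - c^l(g) = c^r(g) · c(s(g))⁻¹`. -/
theorem rightInvariant_sub_leftInvariant_spec (g : G) :
    (⟨g, (𝒱.rightInvariant c - 𝒱.leftInvariant c) g⟩ : TotalSpace FV V) =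
      𝒱.mul ⟨g, 𝒱.rightInvariant c g⟩ (𝒱.inv ⟨𝒢.one (𝒢.src g), c.1 (𝒢.src g)⟩) := by
  -- The inverse of c(s(g)) lies over the inverse of a unit, which equals that unit only
  -- propositionally. Naming it as a vector w in the fibre over the unit lets fibrewise addition
  -- apply to it.
  obtain ⟨w, hw⟩ : ∃ w : V (𝒢.one (𝒢.src g)),
      𝒱.inv ⟨𝒢.one (𝒢.src g), c.1 (𝒢.src g)⟩ = ⟨𝒢.one (𝒢.src g), w⟩ := by
    have hp : (𝒱.inv ⟨𝒢.one (𝒢.src g), c.1 (𝒢.src g)⟩).proj = 𝒢.one (𝒢.src g) := by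
      obtain ⟨L, hL⟩ := 𝒱.linear_inv (𝒢.one (𝒢.src g))
      rw [hL]
      exact inv_one _
    generalize 𝒱.inv ⟨𝒢.one (𝒢.src g), c.1 (𝒢.src g)⟩ = z at hp
    obtain ⟨k, w⟩ := z
    obtain rfl : k = _ := hp
    exact ⟨w, rfl⟩
  have hr := 𝒱.rightInvariant_inv_composable c g
  have hl := 𝒱.core_left_composable c g
  have hs := 𝒱.leftInvariant_spec c g
  -- The zero vector over a unit of `𝒢` is itself a unit of `𝒱`, and it is the one at the source of
  -- c^r(g).
  have hu : 𝒱.mul ⟨g, 𝒱.rightInvariant c g⟩ ⟨𝒢.one (𝒢.src g), 0⟩ =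
      ⟨g, 𝒱.rightInvariant c g⟩ := by
    rw [← 𝒱.linear_one.map_zero, ← 𝒱.src_rightInvariant c g, 𝒱.mul_one]
  rw [hw] at hr hl hs ⊢
  -- Interchange law: (c^r(g) + 0_g) · (0 + w) = c^r(g) · 0 + 0_g · w = c^r(g) - c^l(g).
  have h := 𝒱.mul_add (𝒢.tgt_one _).symm (w := 0)
    (by rw [src_rightInvariant, 𝒱.linear_tgt.map_zero, 𝒢.tgt_one]) hl hu hs.symm
  rw [add_zero, zero_add] at h
  rw [h, ContMDiffSection.coe_sub, Pi.sub_apply, sub_eq_add_neg]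

/-- The section `c^r - c^l` is multiplicative and covers `tgt ∘ c`. -/
theorem isMultiplicative_rightInvariant_sub_leftInvariant :
    𝒱.IsMultiplicative (𝒱.rightInvariant c - 𝒱.leftInvariant c) := by
  have he : ∀ x, (𝒱.tgt ⟨𝒢.one x, c.1 x⟩).proj = x := fun x ↦ by
    obtain ⟨T, hT⟩ := 𝒱.linear_tgt (𝒢.one x)
    rw [hT]
    exact 𝒢.tgt_one x
  let e : Cₛ^∞⟮J; FE, E⟯ :=
    sectionOfMap (fun x ↦ 𝒱.tgt ⟨𝒢.one x, c.1 x⟩) (𝒱.contMDiff_tgt.comp c.2.1) he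
  have e_spec : ∀ x, (⟨x, e x⟩ : TotalSpace FE E) = 𝒱.tgt ⟨𝒢.one x, c.1 x⟩ :=
    sectionOfMap_spec _ _ _
  have hcomp := 𝒱.rightInvariant_inv_composable c
  refine ⟨e, (𝒱.rightInvariant c - 𝒱.leftInvariant c).contMDiff, e.contMDiff, fun g ↦ ?_,
    fun g ↦ ?_, fun x ↦ ?_, fun g h hgh ↦ ?_⟩
  · rw [rightInvariant_sub_leftInvariant_spec, 𝒱.src_mul _ _ (hcomp g), 𝒱.src_inv, e_spec]
  · rw [rightInvariant_sub_leftInvariant_spec, 𝒱.tgt_mul _ _ (hcomp g), rightInvariant_spec,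
      𝒱.tgt_mul _ _ (𝒱.core_right_composable c g), e_spec]
  · rw [rightInvariant_sub_leftInvariant_spec, rightInvariant_one, 𝒢.src_one, 𝒱.mul_inv, e_spec]
  · have hz : 𝒱.src ⟨g, 𝒱.rightInvariant c g⟩ = 𝒱.tgt ⟨h, 0⟩ := by
      rw [src_rightInvariant, 𝒱.linear_tgt.map_zero, hgh]
    -- The two inner factors cancel since s(g) = t(h): c(s(g))⁻¹ · c(t(h)) · 0_h = 0_h. What is left
    -- is c^r(g) · 0_h · c(s(h))⁻¹ = c^r(gh) · c(s(gh))⁻¹.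
    have hcan : 𝒱.mul (𝒱.inv ⟨𝒢.one (𝒢.src g), c.1 (𝒢.src g)⟩) ⟨h, 𝒱.rightInvariant c h⟩ =
        ⟨h, 0⟩ := by
      rw [hgh, rightInvariant_spec, 𝒱.inv_mul_cancel_left (𝒱.core_right_composable c h)]
    have hc : 𝒱.src (𝒱.inv ⟨𝒢.one (𝒢.src g), c.1 (𝒢.src g)⟩) =
        𝒱.tgt ⟨h, 𝒱.rightInvariant c h⟩ := by
      rw [𝒱.src_inv, rightInvariant_spec, 𝒱.tgt_mul _ _ (𝒱.core_right_composable c h), hgh]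
    simp only [rightInvariant_sub_leftInvariant_spec]
    rw [← 𝒱.mul_assoc _ _ _ ((𝒱.src_mul _ _ (hcomp g)).trans hc) (hcomp h),
      𝒱.mul_assoc _ _ _ (hcomp g) hc, hcan, 𝒱.rightInvariant_mul c hgh, 𝒢.src_mul g h hgh]

end VBGroupoid

/-! ### Brackets among right invariant, left invariant and multiplicative sections. -/

namespace LAGroupoid

variable [LieAlgebroid I FV V] [LieAlgebroid J FE E] (𝒱 : LAGroupoid 𝒢 FV V FE E)

/-- Composability for the pair (c^r, 0), with 0 as a section of V so that `mul_bracket` applies. -/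
theorem src_rightInvariant_eq_tgt_zero (c : 𝒱.coreSections) (g h : G)
    (hgh : 𝒢.src g = 𝒢.tgt h) :
    𝒱.src ⟨g, 𝒱.rightInvariant c g⟩ = 𝒱.tgt ⟨h, (0 : Cₛ^∞⟮I; FV, V⟯) h⟩ := by
  rw [𝒱.src_rightInvariant, hgh]
  exact (𝒱.linear_tgt.map_zero h).symm

/-- Right invariant sections commute with left invariant sections. -/
theorem rightInvariant_lie_leftInvariant (c d : 𝒱.coreSections) :
    ⁅𝒱.rightInvariant c, 𝒱.leftInvariant d⁆ = 0 := by
  refine ContMDiffSection.ext fun g ↦ ?_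
  -- The pairs (c^r, 0) → c^r and (0, d^l) → d^l bracket to ([c^r, 0], [0, d^l]) = (0, 0).
  -- Evaluating at the composable pair (1_{t(g)}, g) reaches every g.
  have h := 𝒱.mul_bracket (Y₁ := 0) (𝒱.src_rightInvariant_eq_tgt_zero c)
    (fun g h hgh ↦ (𝒱.linear_src.map_zero g).trans (by rw [𝒱.tgt_leftInvariant d, hgh]))
    (fun _ _ h ↦ 𝒱.rightInvariant_mul c h) (fun _ _ h ↦ 𝒱.mul_leftInvariant d h)
    (𝒢.src_one (𝒢.tgt g))
  rw [lie_zero, zero_lie, 𝒢.one_mul] at h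
  have h' := h.symm.trans (𝒱.mul_zero_zero (𝒢.src_one (𝒢.tgt g)))
  rw [𝒢.one_mul, TotalSpace.mk_inj] at h'
  exact h'

theorem leftInvariant_lie_rightInvariant (c d : 𝒱.coreSections) :
    ⁅𝒱.leftInvariant c, 𝒱.rightInvariant d⁆ = 0 := by
  rw [← lie_skew, rightInvariant_lie_leftInvariant, neg_zero]

theorem rightInvariant_lie (c d : 𝒱.coreSections) :
    𝒱.rightInvariant ⁅c, d⁆ = ⁅𝒱.rightInvariant c, 𝒱.rightInvariant d⁆ :=
  𝒱.rightInvariant_coreBracket c d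

/-- Inversion relates [c^r, d^r] both to -[c, d]^l and to [-c^l, -d^l]. The two signs inside the
second bracket cancel, which leaves the one on the right-hand side. -/
theorem leftInvariant_lie (c d : 𝒱.coreSections) :
    𝒱.leftInvariant ⁅c, d⁆ = -⁅𝒱.leftInvariant c, 𝒱.leftInvariant d⁆ := by
  refine neg_injective (𝒱.eq_of_inv_related (𝒱.inv_rightInvariant ⁅c, d⁆) fun g ↦ ?_)
  rw [rightInvariant_lie, neg_neg, 𝒱.morphism_inv.map_bracket (𝒱.inv_rightInvariant c)
    (𝒱.inv_rightInvariant d), neg_lie, lie_neg, neg_neg]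

/-- The derivative `D_X c` of a core section `c` along a multiplicative section `X`: the
restriction of `[X, c^r]` to the units. -/
noncomputable def coreDerivative (X : 𝒱.multiplicativeSections) (c : 𝒱.coreSections) : 𝒱.coreSections :=
  ⟨fun x ↦ (⁅(X : Cₛ^∞⟮I; FV, V⟯), 𝒱.rightInvariant c⁆ : Cₛ^∞⟮I; FV, V⟯) (𝒢.one x),
    (⁅(X : Cₛ^∞⟮I; FV, V⟯), 𝒱.rightInvariant c⁆ : Cₛ^∞⟮I; FV, V⟯).contMDiff.comp
      𝒢.contMDiff_one,
    fun x ↦ by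
      obtain ⟨e, he⟩ := X.2
      -- The source map relates X to e and c^r to 0, hence [X, c^r] to [e, 0] = 0; so the
      -- restriction to the units takes values in the core.
      have h := 𝒱.morphism_src.map_bracket (Y' := 0) he.src (𝒱.src_rightInvariant c) (𝒢.one x)
      rw [lie_zero, 𝒢.src_one] at h
      exact h⟩

/-- `(D_X c)^r = [X, c^r]`. -/
theorem rightInvariant_coreDerivative (X : 𝒱.multiplicativeSections) (c : 𝒱.coreSections) :
    𝒱.rightInvariant (𝒱.coreDerivative X c) =
      ⁅(X : Cₛ^∞⟮I; FV, V⟯), 𝒱.rightInvariant c⁆ := by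
  refine ContMDiffSection.ext fun g ↦ ?_
  obtain ⟨e, he⟩ := X.2
  -- From (X, X) → X and (c^r, 0) → c^r follows ([X, c^r], 0) → [X, c^r]. At (1_{t(g)}, g) this says
  -- that [X, c^r] is the right invariant extension of its restriction to the units.
  have h := 𝒱.mul_bracket (fun g h hgh ↦ by rw [he.src g, he.tgt h, hgh])
    (𝒱.src_rightInvariant_eq_tgt_zero c) (fun g h hgh ↦ (he.mul g h hgh).symm)
    (fun _ _ h ↦ 𝒱.rightInvariant_mul c h) (𝒢.src_one (𝒢.tgt g))
  rw [lie_zero, 𝒢.one_mul] at h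
  have h' := (𝒱.rightInvariant_spec (𝒱.coreDerivative X c) g).trans h
  rw [TotalSpace.mk_inj] at h'
  exact h'

/-- `(D_X c)^l = [X, c^l]`. -/
theorem leftInvariant_coreDerivative (X : 𝒱.multiplicativeSections) (c : 𝒱.coreSections) :
    𝒱.leftInvariant (𝒱.coreDerivative X c) =
      ⁅(X : Cₛ^∞⟮I; FV, V⟯), 𝒱.leftInvariant c⁆ := by
  obtain ⟨e, he⟩ := X.2
  refine neg_injective (𝒱.eq_of_inv_related (𝒱.inv_rightInvariant _) fun g ↦ ?_)
  -- X is related to itself by inversion, being a groupoid morphism, and c^r to -c^l; hence [X, c^r]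
  -- is related to -[X, c^l].
  rw [rightInvariant_coreDerivative, 𝒱.morphism_inv.map_bracket he.inv
    (𝒱.inv_rightInvariant c), lie_neg]

/-! ### The morphisms δ and D, and the crossed module. -/

/-- The Lie algebra morphism `δ : c ↦ c^r - c^l` from core sections to multiplicative sections. -/
noncomputable def coreBoundary : 𝒱.coreSections →ₗ⁅ℝ⁆ 𝒱.multiplicativeSections where
  toFun c := ⟨𝒱.rightInvariant c - 𝒱.leftInvariant c,
    𝒱.isMultiplicative_rightInvariant_sub_leftInvariant c⟩
  map_add' c d := Subtype.ext (by
    change 𝒱.rightInvariant (c + d) - 𝒱.leftInvariant (c + d) = (𝒱.rightInvariant c - 𝒱.leftInvariant c) +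
      (𝒱.rightInvariant d - 𝒱.leftInvariant d)
    rw [𝒱.rightInvariant_add, 𝒱.leftInvariant_add, add_sub_add_comm])
  map_smul' a c := Subtype.ext (by
    change 𝒱.rightInvariant (a • c) - 𝒱.leftInvariant (a • c) = a • (𝒱.rightInvariant c - 𝒱.leftInvariant c)
    rw [𝒱.rightInvariant_smul, 𝒱.leftInvariant_smul, smul_sub])
  map_lie' {c d} := Subtype.ext (by
    change 𝒱.rightInvariant ⁅c, d⁆ - 𝒱.leftInvariant ⁅c, d⁆ = ⁅𝒱.rightInvariant c - 𝒱.leftInvariant c,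
      𝒱.rightInvariant d - 𝒱.leftInvariant d⁆
    -- The mixed brackets vanish, and the minus sign in [c, d]^l = -[c^l, d^l] matches the sign of
    -- [c^l, d^l] in the expansion.
    rw [rightInvariant_lie, leftInvariant_lie, sub_lie, lie_sub, lie_sub,
      rightInvariant_lie_leftInvariant, leftInvariant_lie_rightInvariant, sub_zero, zero_sub])

/-- The action `X ↦ D_X` of multiplicative sections on core sections by derivations. -/
noncomputable def coreAction : 𝒱.multiplicativeSections →ₗ⁅ℝ⁆ LieDerivation ℝ 𝒱.coreSections 𝒱.coreSections where
  toFun X :=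
    { toFun := 𝒱.coreDerivative X
      map_add' := fun c d ↦ 𝒱.rightInvariant_injective (by
        simp only [rightInvariant_coreDerivative, 𝒱.rightInvariant_add, lie_add])
      map_smul' := fun a c ↦ 𝒱.rightInvariant_injective (by
        simp only [rightInvariant_coreDerivative, 𝒱.rightInvariant_smul, lie_smul,
          RingHom.id_apply])
      leibniz' := fun c d ↦ 𝒱.rightInvariant_injective (by
        change 𝒱.rightInvariant (𝒱.coreDerivative X ⁅c, d⁆) =
          𝒱.rightInvariant (⁅c, 𝒱.coreDerivative X d⁆ - ⁅d, 𝒱.coreDerivative X c⁆)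
        -- `LieDerivation` states the Leibniz rule as [c, Dd] - [d, Dc]; skew symmetry turns it into
        -- the sum [c, Dd] + [Dc, d], and the claim becomes the Jacobi identity for X, c^r, d^r.
        rw [← lie_skew d, sub_neg_eq_add, 𝒱.rightInvariant_add]
        simp only [rightInvariant_coreDerivative, rightInvariant_lie]
        rw [leibniz_lie, add_comm]) }
  map_add' X Y := LieDerivation.ext fun c ↦ 𝒱.rightInvariant_injective (by
    change 𝒱.rightInvariant (𝒱.coreDerivative (X + Y) c) =
      𝒱.rightInvariant (𝒱.coreDerivative X c + 𝒱.coreDerivative Y c)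
    simp only [rightInvariant_coreDerivative, 𝒱.rightInvariant_add]
    exact add_lie _ _ _)
  map_smul' a X := LieDerivation.ext fun c ↦ 𝒱.rightInvariant_injective (by
    change 𝒱.rightInvariant (𝒱.coreDerivative (a • X) c) =
      𝒱.rightInvariant (a • 𝒱.coreDerivative X c)
    simp only [rightInvariant_coreDerivative, 𝒱.rightInvariant_smul]
    exact smul_lie _ _ _)
  map_lie' {X Y} := LieDerivation.ext fun c ↦ 𝒱.rightInvariant_injective (by
    rw [LieDerivation.lie_apply]
    change 𝒱.rightInvariant (𝒱.coreDerivative ⁅X, Y⁆ c) =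
      𝒱.rightInvariant (𝒱.coreDerivative X (𝒱.coreDerivative Y c) -
        𝒱.coreDerivative Y (𝒱.coreDerivative X c))
    rw [sub_eq_add_neg, ← neg_one_smul ℝ, 𝒱.rightInvariant_add, 𝒱.rightInvariant_smul,
      neg_one_smul, ← sub_eq_add_neg]
    simp only [rightInvariant_coreDerivative]
    exact lie_lie _ _ _)

/-- The crossed module of core sections and multiplicative sections of an LA-groupoid. -/
noncomputable def crossedModule : LieCrossedModule ℝ 𝒱.coreSections 𝒱.multiplicativeSections where
  bd := 𝒱.coreBoundary
  act := 𝒱.coreAction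
  act_bd c b := 𝒱.rightInvariant_injective (by
    change 𝒱.rightInvariant (𝒱.coreDerivative (𝒱.coreBoundary c) b) = _
    rw [rightInvariant_coreDerivative, rightInvariant_lie]
    change ⁅𝒱.rightInvariant c - 𝒱.leftInvariant c, 𝒱.rightInvariant b⁆ = _
    -- Only [c^r, b^r] survives, because c^l commutes with b^r.
    rw [sub_lie, leftInvariant_lie_rightInvariant, sub_zero])
  bd_act X c := Subtype.ext (by
    change 𝒱.rightInvariant (𝒱.coreDerivative X c) - 𝒱.leftInvariant (𝒱.coreDerivative X c) =
      ⁅(X : Cₛ^∞⟮I; FV, V⟯), 𝒱.rightInvariant c - 𝒱.leftInvariant c⁆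
    rw [rightInvariant_coreDerivative, leftInvariant_coreDerivative, lie_sub])

end LAGroupoid

end CrossedModule

theorem theorem4p2
    {EG EM G M FV FE : Type*} {V : G → Type*} {E : M → Type*}
    -- the Lie groupoid `G ⇉ M`
    [NormedAddCommGroup EG] [NormedSpace ℝ EG] [FiniteDimensional ℝ EG]
    [NormedAddCommGroup EM] [NormedSpace ℝ EM] [FiniteDimensional ℝ EM]
    [TopologicalSpace G] [T2Space G] [ChartedSpace EG G] [IsManifold 𝓘(ℝ, EG) ∞ G]
    [TopologicalSpace M] [T2Space M] [ChartedSpace EM M] [IsManifold 𝓘(ℝ, EM) ∞ M]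
    (𝒢 : LieGroupoid 𝓘(ℝ, EG) 𝓘(ℝ, EM) G M)
    -- the Lie algebroid `V → G`
    [NormedAddCommGroup FV] [NormedSpace ℝ FV] [FiniteDimensional ℝ FV]
    [TopologicalSpace (TotalSpace FV V)]
    [∀ g, AddCommGroup (V g)] [∀ g, Module ℝ (V g)] [∀ g, TopologicalSpace (V g)]
    [FiberBundle FV V] [VectorBundle ℝ FV V] [ContMDiffVectorBundle ∞ FV V 𝓘(ℝ, EG)]
    [LieAlgebroid 𝓘(ℝ, EG) FV V]
    -- the Lie algebroid `E → M`
    [NormedAddCommGroup FE] [NormedSpace ℝ FE] [FiniteDimensional ℝ FE]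
    [TopologicalSpace (TotalSpace FE E)]
    [∀ x, AddCommGroup (E x)] [∀ x, Module ℝ (E x)] [∀ x, TopologicalSpace (E x)]
    [FiberBundle FE E] [VectorBundle ℝ FE E] [ContMDiffVectorBundle ∞ FE E 𝓘(ℝ, EM)]
    [LieAlgebroid 𝓘(ℝ, EM) FE E]
    -- the LA-groupoid `V ⇉ E` over `G ⇉ M`
    (𝒱 : LAGroupoid 𝒢 FV V FE E) :
    -- the multiplicative sections are closed under the bracket of `Γ(V)`
    (∀ X Y : Cₛ^∞⟮𝓘(ℝ, EG); FV, V⟯, 𝒱.IsMultiplicative X → 𝒱.IsMultiplicative Y →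
      𝒱.IsMultiplicative ⁅X, Y⁆) ∧
    -- `[c₁, c₂]` is the unique section of the core with `[c₁, c₂]^r = [c₁^r, c₂^r]`
    (∀ c₁ c₂ b : 𝒱.coreSections,
      𝒱.rightInvariant b = ⁅𝒱.rightInvariant c₁, 𝒱.rightInvariant c₂⁆ ↔ b = ⁅c₁, c₂⁆) ∧
    -- `δ` and `D` form a crossed module of Lie algebras
    ∃ 𝒳 : LieCrossedModule ℝ 𝒱.coreSections 𝒱.multiplicativeSections,
      (∀ c : 𝒱.coreSections,
        (𝒳.bd c : Cₛ^∞⟮𝓘(ℝ, EG); FV, V⟯) = 𝒱.rightInvariant c - 𝒱.leftInvariant c) ∧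
      (∀ (X : 𝒱.multiplicativeSections) (c : 𝒱.coreSections) (x : M),
        (𝒳.act X c : ∀ x, V (𝒢.one x)) x =
          (⁅(X : Cₛ^∞⟮𝓘(ℝ, EG); FV, V⟯), 𝒱.rightInvariant c⁆ :
            Cₛ^∞⟮𝓘(ℝ, EG); FV, V⟯) (𝒢.one x)) := by
  refine ⟨fun X Y hX hY ↦ 𝒱.multiplicativeSections.lie_mem hX hY, fun c₁ c₂ b ↦ ?_,
    𝒱.crossedModule, fun c ↦ rfl, fun X c x ↦ rfl⟩
  -- Existence is the formula for [c₁, c₂]^r; uniqueness is the injectivity of c ↦ c^r.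
  rw [← 𝒱.rightInvariant_lie]
  exact 𝒱.rightInvariant_injective.eq_iff
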